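/- For a positive integer $n$ put $$C_n=\sum_{l=1}^{n-1}(-1)^{l+1}\csc\frac{\pi l}{n},$$ and let $B_k$ denote the Bernoulli numbers ($\frac{z}{e^z-1}=\sum_{k\ge0}B_k\frac{z^k}{k!}$). (i) There is a natural number $n_0$ such that, for every integer $N\ge 2$ and all even $n>n_0$, $$C_n=\frac{2n\ln 2}{\pi}+2\sum_{r=1}^{N-1}\frac{(-1)^{r+1}\left(2^{2r-1}-1\right)\left(2^{2r}-1\right)\pi^{2r-1}B_{2r}^2}{r\,(2r)!\,n^{2r-1}}+O\!\left(n^{1-2N}\right),$$ where the constant implied by $O$ depends only on $N$. (ii) As $n\to\infty$ through the even integers, the infinite series formed with these terms is a complete asymptotic expansion of $C_n$ in the sense of Poincaré with respect to the scale $n,n^{-1},n^{-3},n^{-5},\dots$: for every $K\ge0$, the difference between $C_n$ and $\frac{2n\ln 2}{\pi}+2\sum_{r=1}^{K}\frac{(-1)^{r+1}(2^{2r-1}-1)(2^{2r}-1)\pi^{2r-1}B_{2r}^2}{r\,(2r)!\,n^{2r-1}}$ is $o(n^{1-2K})$. Its first terms are, for even $n\to\infty$, $$C_n=\frac{2n\ln2}{\pi}+\frac{\pi}{12\,n}-\frac{7\pi^3}{1440\,n^3}+\frac{31\pi^5}{30240\,n^5}-\frac{2159\pi^7}{4838400\,n^7}+O\!\left(n^{-9}\right).$$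 (iii) If $n$ is odd, then $C_n=0$. -/

import Mathlib

open Filter Asymptotics
open scoped Nat

/-- The cosecant; it is only used at points where the sine does not vanish. -/
noncomputable def csc (x : ℝ) : ℝ := 1 / Real.sin x

/-- The sum `C_n`, the alternating sum of `csc (π l / n)` over `1 ≤ l ≤ n - 1`. -/
noncomputable def altCscSum (n : ℕ) : ℝ :=
  ∑ l ∈ Finset.Icc 1 (n - 1), (-1 : ℝ) ^ (l + 1) * csc (Real.pi * l / n)

/-- `∑ a k * u k` is a complete asymptotic expansion (in the sense of Poincaré) of `f` along `l`:
the functions `u k` form an asymptotic scale, and each partial sum approximates `f` with an error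
negligible against the last term of the scale that was kept. -/
def IsCompleteAsymptoticExpansion (l : Filter ℕ) (f : ℕ → ℝ) (u : ℕ → ℕ → ℝ) (a : ℕ → ℝ) : Prop :=
  (∀ k, u (k + 1) =o[l] u k) ∧
    ∀ K, (fun n => f n - ∑ k ∈ Finset.range (K + 1), a k * u k n) =o[l] u K

open MeasureTheory Set Real

/-! Euler's reflection formula writes `π / sin (π a)` as the integral over the line of `exp (a s) /
(1 + exp s)`. Taking `a = l / n` turns the alternating sum into a geometric sum in `exp (s / n)`.
For even `n` this leaves an even kernel, which on the half-line splits into `1 / (1 + exp (s / n))`,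
giving the term with `log 2`, and `tanh (s / (2 n)) / (1 + exp s)` (`pi_mul_altCscSum`).

Expanding `tanh` in powers of `s / n` and integrating term by term gives the rest. Each coefficient
is a Taylor coefficient of `tanh` times a moment of `1 / (1 + exp s)`; both are multiples of the
same even zeta value, whence the squared Bernoulli number. The Taylor series has a finite radius of
convergence, but its truncation error is at most a constant times the next power for every `y > 0`
(`tanhHalf_remainder`), so the error can be integrated over the whole half-line. -/

/-! ### Integral representation of the cosecant sum -/

theorem integral_rpow_mul_one_sub_rpow {a : ℝ} (h0 : 0 < a) (h1 : a < 1) :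
    ∫ x in Ioo (0 : ℝ) 1, x ^ (a - 1) * (1 - x) ^ (-a) = π / sin (π * a) := by
  have key := Complex.Gamma_mul_Gamma_eq_betaIntegral (s := (a : ℂ)) (t := ((1 - a : ℝ) : ℂ))
    (by simpa using h0) (by simp only [Complex.ofReal_re]; linarith)
  have e1 : (a : ℂ) + ((1 - a : ℝ) : ℂ) = 1 := by push_cast; ring
  rw [e1, Complex.Gamma_one, one_mul, Complex.Gamma_ofReal, Complex.Gamma_ofReal,
    ← Complex.ofReal_mul, Real.Gamma_mul_Gamma_one_sub, Complex.betaIntegral,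
    intervalIntegral.integral_of_le zero_le_one, integral_Ioc_eq_integral_Ioo] at key
  have : ∫ x in Ioo (0 : ℝ) 1, (x : ℂ) ^ ((a : ℂ) - 1) * (1 - (x : ℂ)) ^ (((1 - a : ℝ) : ℂ) - 1)
      = ∫ x in Ioo (0 : ℝ) 1, ((x ^ (a - 1) * (1 - x) ^ (-a) : ℝ) : ℂ) := by
    refine setIntegral_congr_fun measurableSet_Ioo fun x hx => ?_
    have hx1 : 0 ≤ 1 - x := by linarith [hx.2]
    rw [Complex.ofReal_mul, Complex.ofReal_cpow hx.1.le, Complex.ofReal_cpow hx1]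
    push_cast
    congr 2
    ring
  rw [this, integral_complex_ofReal] at key
  exact_mod_cast key.symm

/-- The substitution `x = sigmoid s` in the beta integral. -/
theorem integral_exp_mul_sigmoid {a : ℝ} (h0 : 0 < a) (h1 : a < 1) :
    ∫ s : ℝ, exp (a * s) * sigmoid (-s) = π / sin (π * a) := by
  have h := integral_image_eq_integral_abs_deriv_smul (s := univ) (f := sigmoid)
    (f' := fun x => sigmoid x * (1 - sigmoid x)) MeasurableSet.univ
    (fun x _ => (hasDerivAt_sigmoid x).hasDerivWithinAt) (sigmoid_injective.injOn)
    (fun x => x ^ (a - 1) * (1 - x) ^ (-a))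
  rw [image_univ, range_sigmoid, integral_rpow_mul_one_sub_rpow h0 h1, setIntegral_univ] at h
  rw [h]
  congr 1
  ext s
  have hp := sigmoid_pos s
  have hq := sigmoid_pos (-s)
  have he : sigmoid s = exp s * sigmoid (-s) := by
    have := sigmoid_mul_rexp_neg (-s)
    rw [neg_neg] at this
    rw [← this, mul_comm]
  rw [← sigmoid_neg, abs_of_pos (mul_pos hp hq), smul_eq_mul, rpow_sub_one hp.ne', rpow_neg hq.le]
  have hr : sigmoid s ^ a = exp (a * s) * sigmoid (-s) ^ a := by
    conv_lhs => rw [he]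
    rw [mul_rpow (exp_pos _).le hq.le, ← exp_mul, mul_comm s a]
  rw [hr]
  have := (rpow_pos_of_pos hq a).ne'
  field_simp

theorem integrable_exp_mul_sigmoid {a : ℝ} (h0 : 0 < a) (h1 : a < 1) :
    Integrable fun s : ℝ => exp (a * s) * sigmoid (-s) := by
  by_contra h
  have h2 := integral_exp_mul_sigmoid h0 h1
  -- A non-integrable function has integral 0 by convention, whereas the value found is positive.
  rw [integral_undef h] at h2
  have : 0 < sin (π * a) := sin_pos_of_pos_of_lt_pi (by positivity) (by nlinarith [pi_pos])
  exact (div_pos pi_pos this).ne h2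

theorem alternating_geom_sum (z : ℝ) (hz : 0 < z) {n : ℕ} (hn : Even n) (h0 : 0 < n) :
    ∑ l ∈ Finset.Icc 1 (n - 1), (-1 : ℝ) ^ (l + 1) * z ^ l = (z + z ^ n) / (1 + z) := by
  obtain ⟨m, rfl⟩ := hn
  obtain ⟨k, rfl⟩ : ∃ k, m = k + 1 := ⟨m - 1, by omega⟩
  have hz' : 1 + z ≠ 0 := by positivity
  rw [eq_div_iff hz']
  clear h0
  induction k with
  | zero => simp; ring
  | succ k ih =>
    have : k + 1 + 1 + (k + 1 + 1) - 1 = (k + 1 + (k + 1) - 1) + 1 + 1 := by omega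
    rw [this, Finset.sum_Icc_succ_top (by omega), Finset.sum_Icc_succ_top (by omega), add_mul,
      add_mul, ih]
    have : k + 1 + (k + 1) - 1 = 2 * k + 1 := by omega
    rw [this]
    have e1 : (-1 : ℝ) ^ (2 * k + 1 + 1 + 1) = -1 := by
      rw [show 2 * k + 1 + 1 + 1 = 2 * (k + 1) + 1 by ring, pow_succ, pow_mul]; simp
    have e2 : (-1 : ℝ) ^ (2 * k + 1 + 1 + 1 + 1) = 1 := by
      rw [show 2 * k + 1 + 1 + 1 + 1 = 2 * (k + 2) by ring, pow_mul]; simp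
    rw [e1, e2]
    ring

/-- The kernel whose integral over the line is `π` times the alternating cosecant sum. -/
theorem alternating_exp_sum {n : ℕ} (hn : Even n) (h0 : 0 < n) (s : ℝ) :
    ∑ l ∈ Finset.Icc 1 (n - 1), (-1 : ℝ) ^ (l + 1) * (exp ((l / n : ℝ) * s) * sigmoid (-s))
      = sigmoid (-(s / n)) + (2 * sigmoid (s / n) - 1) * sigmoid (-s) := by
  have hn' : (n : ℝ) ≠ 0 := by positivity
  have e : ∀ l : ℕ, exp ((l / n : ℝ) * s) = exp (s / n) ^ l := fun l => by
    rw [← exp_nat_mul]; congr 1; ring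
  simp_rw [e, ← mul_assoc, ← Finset.sum_mul, alternating_geom_sum _ (exp_pos (s / n)) hn h0]
  have en : exp (s / n) ^ n = exp s := by rw [← exp_nat_mul]; congr 1; field_simp
  rw [en]
  simp only [sigmoid_def, neg_neg, exp_neg]
  have h1 := exp_pos s
  have h2 := exp_pos (s / n)
  field_simp
  ring

/-- Evenness of the kernel reduces the integral over the line to twice that over the half-line. -/
theorem csc_kernel_abs (n : ℕ) (s : ℝ) :
    sigmoid (-(|s| / n)) + (2 * sigmoid (|s| / n) - 1) * sigmoid (-|s|)
      = sigmoid (-(s / n)) + (2 * sigmoid (s / n) - 1) * sigmoid (-s) := by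
  rcases abs_cases s with ⟨h, _⟩ | ⟨h, _⟩
  · rw [h]
  · rw [h, neg_div]
    simp only [sigmoid_neg]
    ring

/-- An antiderivative is `n * log (sigmoid (s / n))`, equal to `-n * log 2` at 0 and tending to 0 at
infinity. -/
theorem integral_sigmoid_neg_div {n : ℝ} (hn : 0 < n) :
    IntegrableOn (fun s => sigmoid (-(s / n))) (Ioi 0) ∧
      ∫ s in Ioi (0 : ℝ), sigmoid (-(s / n)) = n * log 2 := by
  have hd : ∀ s ∈ Ici (0 : ℝ), HasDerivAt (fun s => n * log (sigmoid (s / n)))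
      (sigmoid (-(s / n))) s := fun s _ => by
    have h1 : HasDerivAt (fun s => sigmoid (s / n))
        (sigmoid (s / n) * (1 - sigmoid (s / n)) * (1 / n)) s :=
      HasDerivAt.comp (h₂ := sigmoid) (h := fun s => s / n) s (hasDerivAt_sigmoid (s / n))
        ((hasDerivAt_id s).div_const n)
    refine ((h1.log (sigmoid_pos _).ne').const_mul n).congr_deriv ?_
    simp only [sigmoid_neg]
    have := (sigmoid_pos (s / n)).ne'
    field_simp
  have ht : Tendsto (fun s => n * log (sigmoid (s / n))) atTop (nhds 0) := by
    have h1 : Tendsto (fun s : ℝ => sigmoid (s / n)) atTop (nhds 1) :=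
      tendsto_sigmoid_atTop.comp (tendsto_id.atTop_div_const hn)
    have := ((continuousAt_log one_ne_zero).tendsto.comp h1).const_mul n
    simpa using this
  refine ⟨integrableOn_Ioi_deriv_of_nonneg' hd (fun s _ => sigmoid_nonneg _) ht, ?_⟩
  rw [integral_Ioi_of_hasDerivAt_of_nonneg' hd (fun s _ => sigmoid_nonneg _) ht]
  simp

theorem pi_mul_altCscSum {n : ℕ} (hn : Even n) (h0 : 0 < n) :
    IntegrableOn (fun s => (2 * sigmoid (s / n) - 1) * sigmoid (-s)) (Ioi 0) ∧
    π * altCscSum n = 2 * n * log 2 +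
      2 * ∫ s in Ioi (0 : ℝ), (2 * sigmoid (s / n) - 1) * sigmoid (-s) := by
  have hn' : (0 : ℝ) < n := by positivity
  have hl : ∀ l ∈ Finset.Icc 1 (n - 1), (0 : ℝ) < l / n ∧ (l / n : ℝ) < 1 := fun l hl => by
    rw [Finset.mem_Icc] at hl
    have h1 : (0 : ℝ) < l := by exact_mod_cast hl.1
    have h2 : (l : ℝ) < n := by exact_mod_cast (by omega : l < n)
    exact ⟨by positivity, (div_lt_one hn').2 h2⟩
  have hi : ∀ l ∈ Finset.Icc 1 (n - 1), Integrable fun s : ℝ =>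
      (-1 : ℝ) ^ (l + 1) * (exp ((l / n : ℝ) * s) * sigmoid (-s)) := fun l h =>
    (integrable_exp_mul_sigmoid (hl l h).1 (hl l h).2).const_mul _
  have hsum := integral_finsetSum _ hi
  have hint := integrable_finsetSum _ hi
  simp only [alternating_exp_sum hn h0] at hsum hint
  have hI1 := (integral_sigmoid_neg_div hn').1
  have hI2 : IntegrableOn (fun s => (2 * sigmoid (s / n) - 1) * sigmoid (-s)) (Ioi 0) := by
    refine (hint.integrableOn.sub hI1).congr_fun (fun s _ => ?_) measurableSet_Ioi
    simp
  refine ⟨hI2, ?_⟩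
  have hr : ∑ l ∈ Finset.Icc 1 (n - 1), ∫ s : ℝ,
      (-1 : ℝ) ^ (l + 1) * (exp ((l / n : ℝ) * s) * sigmoid (-s)) = π * altCscSum n := by
    rw [altCscSum, Finset.mul_sum]
    refine Finset.sum_congr rfl fun l h => ?_
    rw [integral_const_mul, integral_exp_mul_sigmoid (hl l h).1 (hl l h).2, csc, mul_div_assoc]
    ring
  rw [← hr, ← hsum]
  rw [← integral_congr_ae (ae_of_all _ (csc_kernel_abs n)), integral_comp_abs (f := fun s => sigmoid (-(s / n)) +
    (2 * sigmoid (s / n) - 1) * sigmoid (-s)), integral_add hI1 hI2,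
    (integral_sigmoid_neg_div hn').2]
  ring

/-! ### Expansion of `tanh (y / 2)` with a global remainder bound -/

theorem hasSum_coth_sub_inv {y : ℝ} (hy : 0 < y) :
    HasSum (fun k : ℕ => 2 * y / (y ^ 2 + ((k + 1) * π) ^ 2)) (cosh y / sinh y - 1 / y) := by
  have hpi : (π : ℂ) ≠ 0 := Complex.ofReal_ne_zero.2 pi_ne_zero
  have hyc : (y : ℂ) ≠ 0 := Complex.ofReal_ne_zero.2 hy.ne'
  have hsh : Complex.sinh (y : ℂ) ≠ 0 := by
    rw [← Complex.ofReal_sinh]; exact Complex.ofReal_ne_zero.2 (sinh_pos_iff.2 hy).ne'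
  -- At this imaginary point the partial fractions of `π cot (π z)` become those of `coth y`.
  set z : ℂ := y * Complex.I / π with hz
  have hzc : z ∈ Complex.integerComplement := by
    rw [Complex.mem_integerComplement_iff]
    rintro ⟨m, hm⟩
    have := congrArg Complex.im hm
    have him : z.im = y / π := by
      rw [hz, Complex.div_ofReal_im]; simp
    rw [him, Complex.intCast_im] at this
    exact (div_pos hy pi_pos).ne this
  have h1 := (summable_cotTerm hzc).hasSum
  rw [← cot_series_rep' hzc] at h1
  have e : (π * z : ℂ) = y * Complex.I := by rw [hz]; field_simp
  rw [e, Complex.cot_eq_cos_div_sin, Complex.cos_mul_I, Complex.sin_mul_I] at h1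
  have h2 := h1.mul_left (Complex.I / π)
  rw [← Complex.hasSum_ofReal]
  convert! h2 using 1
  · ext k
    rw [cotTerm_identity hzc, hz]
    have hA : ((y : ℂ) ^ 2 + ((k + 1) * π) ^ 2) ≠ 0 := by
      have : 0 < y ^ 2 + ((k + 1) * π) ^ 2 := by positivity
      exact_mod_cast this.ne'
    have hB : (y * Complex.I / π + (k + 1)) * (y * Complex.I / π - (k + 1))
        = -((y : ℂ) ^ 2 + ((k + 1) * π) ^ 2) / π ^ 2 := by
      field_simp
      ring_nf
      rw [Complex.I_sq]
      ring
    rw [hB]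
    push_cast
    field_simp
    rw [Complex.I_sq]
    ring
  · rw [hz]
    push_cast
    field_simp

theorem geom_remainder {x A : ℝ} (hA : 0 < A) (hx : 0 ≤ x) (M : ℕ) :
    |1 / (x + A) - ∑ r ∈ Finset.range M, (-1) ^ r * x ^ r / A ^ (r + 1)|
      ≤ x ^ M / A ^ (M + 1) := by
  have h : 1 / (x + A) - ∑ r ∈ Finset.range M, (-1) ^ r * x ^ r / A ^ (r + 1)
      = (-1) ^ M * (x ^ M / (A ^ M * (x + A))) := by
    have hxA : x + A ≠ 0 := by positivity
    induction M with
    | zero => simp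
    | succ M ih =>
      rw [Finset.sum_range_succ, ← sub_sub, ih]
      field_simp
      ring
  rw [h, abs_mul, abs_pow, abs_neg, abs_one, one_pow, one_mul, abs_of_nonneg (by positivity),
    pow_succ]
  gcongr
  linarith

/-- The value of the zeta function at the positive even integer `2 r`. -/
noncomputable def evenZeta (r : ℕ) : ℝ := ∑' k : ℕ, 1 / ((k : ℝ) + 1) ^ (2 * r)

theorem summable_evenZeta {r : ℕ} (hr : r ≠ 0) :
    Summable fun k : ℕ => 1 / ((k : ℝ) + 1) ^ (2 * r) := by
  have h := (summable_nat_add_iff 1).2 (hasSum_zeta_nat hr).summable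
  simpa using h

theorem evenZeta_eq {r : ℕ} (hr : r ≠ 0) :
    evenZeta r = (-1 : ℝ) ^ (r + 1) * (2 : ℝ) ^ (2 * r - 1) * π ^ (2 * r) *
        bernoulli (2 * r) / (2 * r)! := by
  have h := hasSum_zeta_nat hr
  rw [← h.tsum_eq, h.summable.tsum_eq_zero_add, evenZeta]
  simp [hr]

theorem evenZeta_pos {r : ℕ} (hr : r ≠ 0) : 0 < evenZeta r :=
  (summable_evenZeta hr).tsum_pos (fun k => by positivity) 0 (by positivity)

/-- `geom_remainder` with `x = y ^ 2` and `A = ((k + 1) π) ^ 2` is applied to each partial fraction,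
then summed over `k`. No smallness of `y` is needed. -/
theorem coth_remainder {y : ℝ} (hy : 0 < y) (M : ℕ) :
    |cosh y / sinh y - 1 / y - ∑ r ∈ Finset.range M,
        2 * (-1) ^ r * evenZeta (r + 1) / π ^ (2 * (r + 1)) * y ^ (2 * r + 1)|
      ≤ 2 * evenZeta (M + 1) / π ^ (2 * (M + 1)) * y ^ (2 * M + 1) := by
  have hz : ∀ r : ℕ, HasSum (fun k : ℕ => 1 / ((k : ℝ) + 1) ^ (2 * (r + 1))) (evenZeta (r + 1)) :=
    fun r => (summable_evenZeta r.succ_ne_zero).hasSum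
  have h1 := (hasSum_coth_sub_inv hy).sub (hasSum_sum (s := Finset.range M) fun r _ =>
    (hz r).mul_left (2 * (-1) ^ r / π ^ (2 * (r + 1)) * y ^ (2 * r + 1)))
  have h2 := (hz M).mul_left (2 / π ^ (2 * (M + 1)) * y ^ (2 * M + 1))
  have h3 := tsum_of_norm_bounded (f := fun k : ℕ => 2 * y / (y ^ 2 + ((k + 1) * π) ^ 2) -
    ∑ r ∈ Finset.range M, 2 * (-1) ^ r / π ^ (2 * (r + 1)) * y ^ (2 * r + 1) *
      (1 / ((k : ℝ) + 1) ^ (2 * (r + 1)))) h2 ?_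
  · rw [h1.tsum_eq, Real.norm_eq_abs] at h3
    calc _ = _ := by
          congr 2
          refine Finset.sum_congr rfl fun r _ => ?_
          ring
      _ ≤ _ := h3
      _ = _ := by ring
  · intro k
    have hA : 0 < ((k + 1 : ℝ) * π) ^ 2 := by positivity
    have h4 := mul_le_mul_of_nonneg_left (geom_remainder hA (sq_nonneg y) M)
      (by positivity : 0 ≤ 2 * y)
    rw [← abs_of_nonneg (by positivity : 0 ≤ 2 * y), ← abs_mul,
      abs_of_nonneg (by positivity : 0 ≤ 2 * y), mul_sub, Finset.mul_sum] at h4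
    rw [Real.norm_eq_abs]
    have hp : ∀ r : ℕ, (((k + 1 : ℝ) * π) ^ 2) ^ r = (k + 1) ^ (2 * r) * π ^ (2 * r) :=
      fun r => by rw [← pow_mul, mul_pow]
    simp only [hp, ← pow_mul] at h4
    calc _ = _ := by
          congr 2
          · ring
          · refine Finset.sum_congr rfl fun r _ => ?_
            field_simp
            ring
      _ ≤ _ := h4
      _ = _ := by field_simp; ring

/-- This is `tanh (y / 2) = 2 coth y - coth (y / 2)`; the poles `2 / y` cancel, so the bounds for
`coth` carry over. -/
theorem two_mul_sigmoid_sub_one {y : ℝ} (hy : 0 < y) :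
    2 * sigmoid y - 1 =
      2 * (cosh y / sinh y - 1 / y) - (cosh (y / 2) / sinh (y / 2) - 1 / (y / 2)) := by
  have h1 : sinh (y / 2) ≠ 0 := (sinh_pos_iff.2 (by positivity)).ne'
  have h2 := (cosh_pos (y / 2)).ne'
  have hs : sinh y = 2 * sinh (y / 2) * cosh (y / 2) := by rw [← sinh_two_mul]; congr 1; ring
  have hc : cosh y = cosh (y / 2) ^ 2 + sinh (y / 2) ^ 2 := by rw [← cosh_two_mul]; congr 1; ring
  have ht : 2 * sigmoid y - 1 = sinh (y / 2) / cosh (y / 2) := by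
    rw [sigmoid_def, cosh_eq, sinh_eq]
    have e1 : exp (-y) = exp (-(y / 2)) ^ 2 := by rw [← exp_nat_mul]; congr 1; push_cast; ring
    have e2 : exp (y / 2) * exp (-(y / 2)) = 1 := by rw [← exp_add]; simp
    rw [e1]
    have h3 := exp_pos (-(y / 2))
    have h4 := exp_pos (y / 2)
    field_simp
    linear_combination -2 * exp (-(y / 2)) * e2
  rw [ht, hs, hc]
  field_simp
  ring

/-- The coefficient of `y ^ (2 r + 1)` in `tanh (y / 2) = 2 * sigmoid y - 1`. -/
noncomputable def tanhHalfCoeff (r : ℕ) : ℝ :=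
  4 * (-1) ^ r * evenZeta (r + 1) / π ^ (2 * (r + 1)) * (1 - 1 / 2 ^ (2 * (r + 1)))

theorem tanhHalf_remainder (M : ℕ) : ∃ D : ℝ, 0 ≤ D ∧ ∀ y : ℝ, 0 < y →
    |2 * sigmoid y - 1 - ∑ r ∈ Finset.range M, tanhHalfCoeff r * y ^ (2 * r + 1)|
      ≤ D * y ^ (2 * M + 1) := by
  have hc : 0 < 2 * evenZeta (M + 1) / π ^ (2 * (M + 1)) := by
    have := evenZeta_pos M.succ_ne_zero
    positivity
  -- The term `2 coth y` contributes 2 and `coth (y / 2)` at most 1, since `(y / 2) ^ (2 * M + 1) ≤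
  -- y ^ (2 * M + 1)`.
  refine ⟨3 * (2 * evenZeta (M + 1) / π ^ (2 * (M + 1))), by positivity, fun y hy => ?_⟩
  have h1 := coth_remainder hy M
  have h2 := coth_remainder (half_pos hy) M
  have h3 : (y / 2) ^ (2 * M + 1) ≤ y ^ (2 * M + 1) := by gcongr; linarith
  have h4 := mul_le_mul_of_nonneg_left h3 hc.le
  have h5 : ∑ r ∈ Finset.range M, tanhHalfCoeff r * y ^ (2 * r + 1) =
      2 * ∑ r ∈ Finset.range M,
        2 * (-1) ^ r * evenZeta (r + 1) / π ^ (2 * (r + 1)) * y ^ (2 * r + 1) -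
      ∑ r ∈ Finset.range M,
        2 * (-1) ^ r * evenZeta (r + 1) / π ^ (2 * (r + 1)) * (y / 2) ^ (2 * r + 1) := by
    rw [Finset.mul_sum, ← Finset.sum_sub_distrib]
    refine Finset.sum_congr rfl fun r _ => ?_
    rw [tanhHalfCoeff, div_pow]
    field_simp
    ring
  rw [two_mul_sigmoid_sub_one hy, h5]
  rw [abs_le] at h1 h2 ⊢
  constructor <;> linarith [h1.1, h1.2, h2.1, h2.2]

/-! ### Moments of `1 / (1 + exp t)` -/

/-- The terms with even `k + 1` sum to `evenZeta r / 2 ^ (2 * r)`; reversing their sign subtracts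
this twice. -/
theorem hasSum_alternating_zeta {r : ℕ} (hr : r ≠ 0) :
    HasSum (fun k : ℕ => (-1 : ℝ) ^ k / ((k : ℝ) + 1) ^ (2 * r))
      ((1 - 2 / 2 ^ (2 * r)) * evenZeta r) := by
  have hs := summable_evenZeta hr
  have ho : Summable fun k : ℕ => 1 / (((2 * k : ℕ) : ℝ) + 1) ^ (2 * r) :=
    hs.comp_injective (i := fun k => 2 * k) fun a b h => by simpa using h
  have he : HasSum (fun k : ℕ => 1 / (((2 * k + 1 : ℕ) : ℝ) + 1) ^ (2 * r))
      (1 / 2 ^ (2 * r) * evenZeta r) := by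
    refine (hs.hasSum.mul_left (1 / 2 ^ (2 * r))).congr_fun fun k => ?_
    push_cast
    rw [show (2 * k + 1 + 1 : ℝ) = 2 * (k + 1) by ring, mul_pow]
    field_simp
  have hO := (HasSum.even_add_odd (f := fun k : ℕ => 1 / ((k : ℝ) + 1) ^ (2 * r))
    ho.hasSum he).tsum_eq
  change evenZeta r = _ at hO
  have h := HasSum.even_add_odd (f := fun k : ℕ => (-1 : ℝ) ^ k / ((k : ℝ) + 1) ^ (2 * r))
    (ho.hasSum.congr_fun fun k => by simp [pow_mul])
    (he.neg.congr_fun fun k => by simp [pow_succ, pow_mul, neg_div])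
  convert! h using 1
  linear_combination hO

theorem hasSum_sigmoid_neg {t : ℝ} (ht : 0 < t) :
    HasSum (fun k : ℕ => (-1 : ℝ) ^ k * exp (-(k + 1 : ℝ) * t)) (sigmoid (-t)) := by
  have h := (hasSum_geometric_of_abs_lt_one (r := -exp (-t))
    (by rw [abs_neg, abs_of_pos (exp_pos _)]; simpa using ht)).mul_left (exp (-t))
  convert! h using 1
  · ext k
    rw [neg_pow (exp (-t)), ← exp_nat_mul, mul_left_comm, ← exp_add]
    congr 2
    ring
  · rw [← sigmoid_mul_rexp_neg, sigmoid_def]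
    ring_nf

/-- The integral is the Mellin transform at `2 r + 2` of the exponential series
`hasSum_sigmoid_neg`, so it is a Gamma factor times the alternating zeta series. -/
theorem integral_pow_mul_sigmoid_neg (r : ℕ) :
    ∫ t in Ioi (0 : ℝ), t ^ (2 * r + 1) * sigmoid (-t) =
      (2 * r + 1)! * ((1 - 2 / 2 ^ (2 * (r + 1))) * evenZeta (r + 1)) := by
  have hA := hasSum_alternating_zeta r.succ_ne_zero
  have hs : (2 * (r : ℂ) + 2).re = ((2 * (r + 1) : ℕ) : ℝ) := by simp; ring
  have h := hasSum_mellin (a := fun k : ℕ => (-1 : ℂ) ^ k) (p := fun k : ℕ => (k + 1 : ℝ))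
    (F := fun t => ((sigmoid (-t) : ℝ) : ℂ)) (s := 2 * r + 2) (fun k => Or.inr (by positivity))
    (by rw [hs]; positivity)
    (fun t ht => by
      have := Complex.hasSum_ofReal.2 (hasSum_sigmoid_neg (t := t) ht)
      push_cast at this ⊢
      exact this)
    (by
      rw [hs]
      simp_rw [rpow_natCast]
      simpa using summable_evenZeta r.succ_ne_zero)
  have hG : Complex.Gamma (2 * r + 2) = (2 * r + 1)! := by
    rw [← Complex.Gamma_nat_eq_factorial]; congr 1; push_cast; ring
  have h2 := (Complex.hasSum_ofReal.2 (hA.mul_left ((2 * r + 1)! : ℝ)))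
  have h3 : mellin (fun t => ((sigmoid (-t) : ℝ) : ℂ)) (2 * r + 2) =
      ((∫ t in Ioi (0 : ℝ), t ^ (2 * r + 1) * sigmoid (-t) : ℝ) : ℂ) := by
    rw [mellin, ← integral_complex_ofReal]
    refine setIntegral_congr_fun measurableSet_Ioi fun t ht => ?_
    have : (2 * r + 2 - 1 : ℂ) = ((2 * r + 1 : ℕ) : ℂ) := by push_cast; ring
    simp only [this, Complex.cpow_natCast, smul_eq_mul]
    push_cast
    rfl
  rw [h3] at h
  refine Complex.ofReal_injective (h.unique ?_)
  convert! h2 using 1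
  ext k
  have e : (2 * r + 2 : ℂ) = ((2 * (r + 1) : ℕ) : ℂ) := by push_cast; ring
  rw [hG, e, Complex.cpow_natCast, Nat.succ_eq_add_one]
  push_cast
  rw [mul_div_assoc]

theorem integrableOn_pow_mul_sigmoid_neg (r : ℕ) :
    IntegrableOn (fun t => t ^ (2 * r + 1) * sigmoid (-t)) (Ioi 0) := by
  by_contra h
  have h2 := integral_pow_mul_sigmoid_neg r
  rw [integral_undef h] at h2
  have h3 := evenZeta_pos r.succ_ne_zero
  have h4 : (0 : ℝ) < 1 - 2 / 2 ^ (2 * (r + 1)) := by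
    rw [sub_pos, div_lt_one (by positivity)]
    calc (2 : ℝ) = 2 ^ 1 := by norm_num
      _ < 2 ^ (2 * (r + 1)) := pow_lt_pow_right₀ (by norm_num) (by omega)
  have h5 : (0 : ℝ) < (2 * r + 1)! * ((1 - 2 / 2 ^ (2 * (r + 1))) * evenZeta (r + 1)) := by
    positivity
  exact h5.ne h2

/-- The coefficient of `n ^ (-(2 r + 1))` in the expansion of the alternating cosecant sum. -/
noncomputable def altCscCoeff (r : ℕ) : ℝ :=
  2 * ((-1) ^ (r + 2) * (2 ^ (2 * (r + 1) - 1) - 1) * (2 ^ (2 * (r + 1)) - 1)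
    * π ^ (2 * (r + 1) - 1) * (bernoulli (2 * (r + 1)) : ℝ) ^ 2
    / (((r + 1 : ℕ) : ℝ) * ((2 * (r + 1))! : ℝ)))

/-- Euler's formula for the zeta value enters twice, so its sign squares away and only the `(-1) ^
r` of the `tanh` coefficient survives. -/
theorem two_div_pi_mul_coeff (r : ℕ) :
    2 / π * (tanhHalfCoeff r * ∫ t in Ioi (0 : ℝ), t ^ (2 * r + 1) * sigmoid (-t))
      = altCscCoeff r := by
  rw [integral_pow_mul_sigmoid_neg, tanhHalfCoeff, altCscCoeff, evenZeta_eq r.succ_ne_zero]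
  have hf : ((2 * (r + 1))! : ℝ) = (2 * (r + 1)) * (2 * r + 1)! := by
    rw [show 2 * (r + 1) = (2 * r + 1) + 1 by ring, Nat.factorial_succ]
    push_cast
    ring
  have h1 : (((2 * r + 1)! : ℕ) : ℝ) ≠ 0 := by positivity
  have e : 2 * (r + 1) - 1 = 2 * r + 1 := by omega
  have e2 : 2 * (r + 1) = 2 * r + 1 + 1 := by omega
  have hm : ((-1 : ℝ) ^ r) ^ 2 = 1 := by rw [← pow_mul, mul_comm, pow_mul]; simp
  rw [hf, e]
  generalize (bernoulli (2 * (r + 1)) : ℝ) = B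
  rw [e2]
  simp only [pow_succ _ (2 * r), pow_succ _ (2 * r + 1), pow_succ (-1 : ℝ)]
  have hp : (2 : ℝ) ^ (2 * r) ≠ 0 := by positivity
  generalize (2 : ℝ) ^ (2 * r) = q at *
  generalize (-1 : ℝ) ^ r = m at *
  push_cast
  field_simp
  ring_nf
  have hm3 : m ^ 3 = m := by rw [pow_succ, hm, one_mul]
  simp only [hm3]

/-! ### The asymptotic expansion -/

/-- The `tanh` bound at `y = t / n` is integrated against `sigmoid (-t)`. As it holds for all `y >
0`, the estimate is uniform over all positive even `n`. -/
theorem altCscSum_remainder (M : ℕ) : ∃ D : ℝ, ∀ n : ℕ, Even n → 0 < n →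
    |altCscSum n - (2 * n * log 2 / π +
      ∑ r ∈ Finset.range M, altCscCoeff r / (n : ℝ) ^ (2 * r + 1))|
      ≤ D * (1 / (n : ℝ) ^ (2 * M + 1)) := by
  obtain ⟨D, hD, hb⟩ := tanhHalf_remainder M
  refine ⟨2 / π * (D * ∫ t in Ioi (0 : ℝ), t ^ (2 * M + 1) * sigmoid (-t)), fun n hn h0 => ?_⟩
  have hn' : (0 : ℝ) < n := by positivity
  obtain ⟨hI, hC⟩ := pi_mul_altCscSum hn h0
  have hi : ∀ r ∈ Finset.range M, IntegrableOn (fun t : ℝ => tanhHalfCoeff r / (n : ℝ) ^ (2 * r + 1)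
      * (t ^ (2 * r + 1) * sigmoid (-t))) (Ioi 0) := fun r _ =>
    (integrableOn_pow_mul_sigmoid_neg r).const_mul _
  have hsum := integral_finsetSum _ hi
  have hint := integrable_finsetSum _ hi
  have key : altCscSum n - (2 * n * log 2 / π +
      ∑ r ∈ Finset.range M, altCscCoeff r / (n : ℝ) ^ (2 * r + 1)) =
      2 / π * ∫ t in Ioi (0 : ℝ), ((2 * sigmoid (t / n) - 1) * sigmoid (-t) -
        ∑ r ∈ Finset.range M, tanhHalfCoeff r / (n : ℝ) ^ (2 * r + 1)
          * (t ^ (2 * r + 1) * sigmoid (-t))) := by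
    rw [integral_sub hI hint, hsum]
    have h1 : altCscSum n = (2 * n * log 2 +
      2 * ∫ s in Ioi (0 : ℝ), (2 * sigmoid (s / n) - 1) * sigmoid (-s)) / π := by
      rw [← hC]; field_simp
    have h2 : ∑ r ∈ Finset.range M, altCscCoeff r / (n : ℝ) ^ (2 * r + 1) =
        2 / π * ∑ r ∈ Finset.range M, ∫ t in Ioi (0 : ℝ), tanhHalfCoeff r / (n : ℝ) ^ (2 * r + 1)
          * (t ^ (2 * r + 1) * sigmoid (-t)) := by
      rw [Finset.mul_sum]
      refine Finset.sum_congr rfl fun r _ => ?_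
      rw [← two_div_pi_mul_coeff, integral_const_mul]
      ring
    rw [h1, h2]
    ring
  rw [key, abs_mul, abs_of_pos (by positivity : 0 < 2 / π), mul_assoc]
  refine mul_le_mul_of_nonneg_left ?_ (by positivity)
  rw [← integral_const_mul, ← integral_mul_const, ← Real.norm_eq_abs]
  refine norm_integral_le_of_norm_le
    (((integrableOn_pow_mul_sigmoid_neg M).const_mul D).mul_const _) ?_
  refine (ae_restrict_iff' measurableSet_Ioi).2 (ae_of_all _ fun t ht => ?_)
  have h := mul_le_mul_of_nonneg_right (hb (t / n) (div_pos ht hn')) (sigmoid_nonneg (-t))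
  rw [Real.norm_eq_abs]
  rw [← abs_of_nonneg (sigmoid_nonneg (-t)), ← abs_mul, abs_of_nonneg (sigmoid_nonneg (-t)),
    sub_mul, Finset.sum_mul] at h
  calc _ = _ := by
        congr 2
        refine Finset.sum_congr rfl fun r _ => ?_
        rw [div_pow]
        ring
    _ ≤ _ := h
    _ = _ := by rw [div_pow]; ring

theorem sum_Icc_one_eq_sum_range (f : ℕ → ℝ) (M : ℕ) :
    ∑ r ∈ Finset.Icc 1 M, f r = ∑ r ∈ Finset.range M, f (r + 1) := by
  induction M with
  | zero => simp
  | succ M ih => rw [Finset.sum_Icc_succ_top (by omega), Finset.sum_range_succ, ih]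

theorem zpow_one_sub_two_mul (x : ℝ) (M : ℕ) :
    x ^ (1 - 2 * ((M + 1 : ℕ) : ℤ)) = 1 / x ^ (2 * M + 1) := by
  rw [show 1 - 2 * ((M + 1 : ℕ) : ℤ) = -((2 * M + 1 : ℕ) : ℤ) by push_cast; ring, zpow_neg,
    zpow_natCast, one_div]

theorem altCscSum_isBigO (M : ℕ) :
    (fun n : ℕ => altCscSum n - (2 * n * log 2 / π +
      ∑ r ∈ Finset.range M, altCscCoeff r / (n : ℝ) ^ (2 * r + 1)))
      =O[𝓟 {n : ℕ | Even n ∧ 0 < n}] fun n : ℕ => (n : ℝ) ^ (1 - 2 * ((M + 1 : ℕ) : ℤ)) := by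
  obtain ⟨D, hD⟩ := altCscSum_remainder M
  refine IsBigO.of_bound D (eventually_principal.2 fun n hn => ?_)
  rw [zpow_one_sub_two_mul, Real.norm_eq_abs, Real.norm_of_nonneg (by positivity)]
  exact hD n hn.1 hn.2

theorem atTop_inf_even_le : atTop ⊓ 𝓟 {n : ℕ | Even n} ≤ 𝓟 {n : ℕ | Even n ∧ 0 < n} := by
  rw [le_principal_iff, mem_inf_principal]
  filter_upwards [eventually_gt_atTop 0] with n hn he using ⟨he, hn⟩

theorem zpow_isLittleO_of_lt {a b : ℤ} (h : a < b) :
    (fun n : ℕ => (n : ℝ) ^ a) =o[atTop] fun n : ℕ => (n : ℝ) ^ b := by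
  have h0 : ∀ᶠ n : ℕ in atTop, (n : ℝ) ≠ 0 := by
    filter_upwards [eventually_ne_atTop 0] with n hn using Nat.cast_ne_zero.2 hn
  refine (isLittleO_iff_tendsto' (h0.mono fun n hn h => absurd h (zpow_ne_zero _ hn))).2 ?_
  refine ((tendsto_zpow_atTop_zero (sub_neg.2 h)).comp
    (tendsto_natCast_atTop_atTop (R := ℝ))).congr' ?_
  filter_upwards [h0] with n hn using zpow_sub₀ hn a b

/-- The reflection `l ↦ n - l` preserves the cosecant and, for odd `n`, reverses the sign `(-1) ^ (l
+ 1)`. -/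
theorem altCscSum_of_odd {n : ℕ} (hn : Odd n) : altCscSum n = 0 := by
  have hn0 : (n : ℝ) ≠ 0 := by exact_mod_cast hn.pos.ne'
  have h : altCscSum n = -altCscSum n := by
    conv_lhs => rw [altCscSum]
    rw [altCscSum, ← Finset.sum_neg_distrib]
    refine Finset.sum_nbij' (fun l => n - l) (fun l => n - l) ?_ ?_ ?_ ?_ ?_
    · intro l hl; simp only [Finset.mem_Icc] at hl ⊢; omega
    · intro l hl; simp only [Finset.mem_Icc] at hl ⊢; omega
    · intro l hl; simp only [Finset.mem_Icc] at hl; omega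
    · intro l hl; simp only [Finset.mem_Icc] at hl; omega
    · intro l hl
      simp only [Finset.mem_Icc] at hl
      have hln : l ≤ n := by omega
      have h1 : π * ((n - l : ℕ) : ℝ) / n = π - π * l / n := by
        rw [Nat.cast_sub hln]; field_simp
      have h2 : (-1 : ℝ) ^ (n - l + 1) = -(-1) ^ (l + 1) := by
        have hs : (-1 : ℝ) ^ (n - l) * (-1) ^ l = -1 := by
          rw [← pow_add, Nat.sub_add_cancel hln, hn.neg_one_pow]
        rcases neg_one_pow_eq_or ℝ l with h | h <;> rw [h] at hs <;>
          simp only [pow_succ, h] <;> linarith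
      rw [h1, h2, csc, csc, sin_pi_sub]
      ring
  linarith

theorem bernoulli_six : bernoulli 6 = 1 / 42 := by
  rw [bernoulli_eq_bernoulli'_of_ne_one (by norm_num), bernoulli'_def]
  norm_num [Finset.sum_range_succ, bernoulli'_eq_zero_of_odd (n := 5) (by decide), Nat.choose]

theorem bernoulli_eight : bernoulli 8 = -1 / 30 := by
  have h6 : bernoulli' 6 = 1 / 42 := by
    rw [← bernoulli_eq_bernoulli'_of_ne_one (by norm_num), bernoulli_six]
  rw [bernoulli_eq_bernoulli'_of_ne_one (by norm_num), bernoulli'_def]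
  norm_num [Finset.sum_range_succ, bernoulli'_eq_zero_of_odd (n := 5) (by decide),
    bernoulli'_eq_zero_of_odd (n := 7) (by decide), h6, Nat.choose]

theorem mainTheorem2 :
    -- for even `n > n₀`, the expansion with remainder, for every `N ≥ 2`
    (∃ n₀ : ℕ, ∀ N : ℕ, 2 ≤ N →
      (fun n : ℕ => altCscSum n -
          (2 * n * Real.log 2 / Real.pi
            + 2 * ∑ r ∈ Finset.Icc 1 (N - 1),
                (-1 : ℝ) ^ (r + 1) * (2 ^ (2 * r - 1) - 1) * (2 ^ (2 * r) - 1)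
                    * Real.pi ^ (2 * r - 1) * (bernoulli (2 * r) : ℝ) ^ 2
                  / (r * ((2 * r)! : ℝ) * (n : ℝ) ^ (2 * r - 1))))
        =O[𝓟 {n : ℕ | Even n ∧ n₀ < n}] (fun n : ℕ => (n : ℝ) ^ (1 - 2 * (N : ℤ)))) ∧
    -- as `n → ∞` through the even numbers, it is the complete asymptotic expansion
    IsCompleteAsymptoticExpansion (atTop ⊓ 𝓟 {n : ℕ | Even n}) altCscSum
      (fun r n => (n : ℝ) ^ (1 - 2 * (r : ℤ)))
      (fun r => if r = 0 then 2 * Real.log 2 / Real.pi else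
        2 * ((-1 : ℝ) ^ (r + 1) * (2 ^ (2 * r - 1) - 1) * (2 ^ (2 * r) - 1)
            * Real.pi ^ (2 * r - 1) * (bernoulli (2 * r) : ℝ) ^ 2
          / (r * ((2 * r)! : ℝ)))) ∧
    -- the first few terms
    (fun n : ℕ => altCscSum n -
        (2 * n * Real.log 2 / Real.pi + Real.pi / (12 * n) - 7 * Real.pi ^ 3 / (1440 * n ^ 3)
          + 31 * Real.pi ^ 5 / (30240 * n ^ 5) - 2159 * Real.pi ^ 7 / (4838400 * n ^ 7)))
      =O[atTop ⊓ 𝓟 {n : ℕ | Even n}] (fun n : ℕ => (n : ℝ) ^ (-9 : ℤ)) ∧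
    -- for odd `n` the sum vanishes
    ∀ n : ℕ, Odd n → altCscSum n = 0 := by
  -- The threshold `n₀ = 0` suffices because the remainder bound holds for every positive even `n`.
  refine ⟨⟨0, fun N hN => ?_⟩, ⟨fun k => ?_, fun K => ?_⟩, ?_, fun n hn => altCscSum_of_odd hn⟩
  · obtain ⟨M, rfl⟩ : ∃ M, N = M + 1 := ⟨N - 1, by omega⟩
    refine (altCscSum_isBigO M).congr_left fun n => ?_
    rw [Nat.add_sub_cancel, sum_Icc_one_eq_sum_range, Finset.mul_sum]
    congr 2
    refine Finset.sum_congr rfl fun r _ => ?_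
    rw [altCscCoeff, show 2 * (r + 1) - 1 = 2 * r + 1 by omega]
    ring
  · refine (zpow_isLittleO_of_lt ?_).mono inf_le_left
    push_cast
    linarith
  -- The error is of the order of the first omitted scale function, hence negligible against the
  -- last one kept.
  · refine (((altCscSum_isBigO K).mono atTop_inf_even_le).congr_left fun n => ?_).trans_isLittleO
      ((zpow_isLittleO_of_lt ?_).mono inf_le_left)
    -- The term `k = 0` is split off: it is the one with `log 2`, on the scale function `n ^ 1`.
    · rw [Finset.sum_range_succ', add_comm (∑ k ∈ Finset.range K, _)]
      refine congrArg (altCscSum n - ·) (congrArg₂ (· + ·) ?_ ?_)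
      · simp; ring
      · refine Finset.sum_congr rfl fun r _ => ?_
        beta_reduce
        rw [if_neg r.succ_ne_zero, zpow_one_sub_two_mul, altCscCoeff]
        ring
    · push_cast
      linarith
  · refine ((altCscSum_isBigO 4).mono atTop_inf_even_le).congr' ?_ (by norm_num)
    refine Eventually.of_forall fun n => ?_
    have h4 : bernoulli 4 = -1 / 30 := by
      rw [bernoulli_eq_bernoulli'_of_ne_one (by norm_num), bernoulli'_four]
    have h2 : bernoulli 2 = 1 / 6 := by rw [bernoulli_two]; norm_num
    have c0 : altCscCoeff 0 = π / 12 := by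
      norm_num [altCscCoeff, h2, Nat.factorial]; ring
    have c1 : altCscCoeff 1 = -(7 * π ^ 3 / 1440) := by
      norm_num [altCscCoeff, h4, Nat.factorial]; ring
    have c2 : altCscCoeff 2 = 31 * π ^ 5 / 30240 := by
      norm_num [altCscCoeff, bernoulli_six, Nat.factorial]; ring
    have c3 : altCscCoeff 3 = -(2159 * π ^ 7 / 4838400) := by
      norm_num [altCscCoeff, bernoulli_eight, Nat.factorial]; ring
    simp only [Finset.sum_range_succ, Finset.sum_range_zero, c0, c1, c2, c3]
    ring
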